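/- Let $n\ge 0$, let $\mathbb F=\mathbb Q(q,t)$ and $\mathbb K=\mathbb Q(q,t,a)$ be fields of rational functions, and write $|\alpha|=\alpha_1+\cdots+\alpha_n$ for a composition $\alpha\in\mathcal C_n=(\mathbb Z_{\ge 0})^n$. For $v\in\mathbb Z^n$ put $$\overline v_i:=q^{v_i}t^{-k_i(v)},\qquad k_i(v):=\#\{k<i\mid v_k\ge v_i\}+\#\{k>i\mid v_k>v_i\},$$ $\overline v:=(\overline v_1,\ldots,\overline v_n)\in\mathbb F^n$, $\overline v^{-1}:=(\overline v_1^{-1},\ldots,\overline v_n^{-1})$, $w_0v:=(v_n,\ldots,v_1)$ and $\widetilde v:=\overline{-w_0v}$; let $\tau:=(1,t^{-1},\ldots,t^{1-n})$. For $\alpha\in\mathcal C_n$, the non-symmetric interpolation Macdonald polynomial $G_\alpha(x)=G_\alpha(x;q,t)\in\mathbb F[x_1,\ldots,x_n]$ is the unique polynomial of degree at most $|\alpha|$ such that $G_\alpha(\overline\beta)=0$ for all $\beta\in\mathcal C_n$ with $|\beta|\le|\alpha|$, $\beta\ne\alpha$, and such that the coefficient of $x^\alpha$ in $G_\alpha$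 is $1$. Put $K_\alpha(x):=G_\alpha(x)/G_\alpha(a\tau)\in\mathbb K[x_1,\ldots,x_n]$. **Theorem C.** For every $\alpha\in\mathcal C_n$: the polynomial $G_\alpha$ exists and is unique, and $G_\alpha(a\tau)\ne 0$; there is a unique polynomial $O_\alpha(x)\in\mathbb K[x_1,\ldots,x_n]$ of degree at most $|\alpha|$ such that $$O_\alpha(\overline\beta^{-1})=\frac{G_\beta(a\widetilde\alpha)}{G_\beta(a\tau)}\qquad\text{for all }\beta\in\mathcal C_n;$$ and, with $w_0x=(x_n,\ldots,x_1)$, $$O_\alpha(x)=K_\alpha(t^{1-n}a\,w_0x)=\frac{G_\alpha(t^{1-n}a\,w_0x)}{G_\alpha(a\tau)}.$$ -/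

import Mathlib

namespace InterpolationMacdonald

/-- The field `𝔽 = ℚ(q, t)` of rational functions in two indeterminates. -/
abbrev F : Type := FractionRing (MvPolynomial (Fin 2) ℚ)

/-- The field `𝕂 = ℚ(q, t, a) = 𝔽(a)`. -/
abbrev K : Type := RatFunc F

/-- The indeterminate `q` of `ℚ(q, t)`. -/
noncomputable def q : F := algebraMap (MvPolynomial (Fin 2) ℚ) F (MvPolynomial.X 0)

/-- The indeterminate `t` of `ℚ(q, t)`. -/
noncomputable def t : F := algebraMap (MvPolynomial (Fin 2) ℚ) F (MvPolynomial.X 1)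

/-- The indeterminate `a` of `ℚ(q, t, a)`. -/
noncomputable def a : K := RatFunc.X

variable {n : ℕ}

/-- `k_i(v) = #{k < i | v_k ≥ v_i} + #{k > i | v_k > v_i}`. -/
def kNum (v : Fin n → ℤ) (i : Fin n) : ℕ :=
  (Finset.univ.filter fun k => k < i ∧ v i ≤ v k).card +
    (Finset.univ.filter fun k => i < k ∧ v i < v k).card

/-- The point `v̄` of `𝔽ⁿ`, with coordinates `q ^ v_i * t ^ (-k_i(v))`. -/
noncomputable def bar (v : Fin n → ℤ) : Fin n → F :=
  fun i => q ^ v i * t ^ (-(kNum v i : ℤ))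

/-- The longest element `w₀` of the symmetric group acting on integral vectors. -/
def w0 (v : Fin n → ℤ) : Fin n → ℤ := fun i => v i.rev

/-- The point `ṽ`, which is the bar of `-w₀ v`. -/
noncomputable def tilde (v : Fin n → ℤ) : Fin n → F := bar (-w0 v)

/-- A composition (vector of natural numbers) as an integral vector. -/
def toInt (α : Fin n → ℕ) : Fin n → ℤ := fun i => (α i : ℤ)

/-- The point `τ = (1, t⁻¹, …, t^(1-n))`. -/
noncomputable def tau : Fin n → F := fun i => t ^ (-((i : ℕ) : ℤ))

/-- The size `|α| = α_1 + ⋯ + α_n`. -/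
def size (α : Fin n → ℕ) : ℕ := ∑ i, α i

/-- The point `a y` of `𝕂ⁿ`, for a point `y` of `𝔽ⁿ`. -/
noncomputable def aMul (y : Fin n → F) : Fin n → K := fun i => a * algebraMap F K (y i)

/-- The defining properties of the non-symmetric interpolation Macdonald polynomial of
degree `α`: its total degree is at most `|α|`, it vanishes at `β̄` for all compositions `β ≠ α`
with `|β| ≤ |α|`, and its coefficient of `x^α` is `1`. -/
structure IsInterpolation (α : Fin n → ℕ) (g : MvPolynomial (Fin n) F) : Prop where
  totalDegree_le : g.totalDegree ≤ size α
  vanishing : ∀ β : Fin n → ℕ, size β ≤ size α → β ≠ α → MvPolynomial.eval (bar (toInt β)) g = 0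
  coeff_eq_one : g.coeff (Finsupp.equivFunOnFinite.symm α) = 1

/-- The non-symmetric interpolation Macdonald polynomial `G_α(x; q, t)`: the polynomial
with the defining properties above. -/
noncomputable def G (α : Fin n → ℕ) : MvPolynomial (Fin n) F :=
  Classical.epsilon (IsInterpolation α)

/-- The principal evaluation `G_α(aτ)`. -/
noncomputable def GatTau (α : Fin n → ℕ) : K := MvPolynomial.aeval (aMul tau) (G α)

/-- The normalized polynomial `K_α(x) = G_α(x) / G_α(aτ)`, with coefficients in `𝕂`. -/
noncomputable def KPoly (α : Fin n → ℕ) : MvPolynomial (Fin n) K :=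
  MvPolynomial.C (GatTau α)⁻¹ * MvPolynomial.map (algebraMap F K) (G α)

/-- The coordinates of `t^(1-n) a w₀ x`: the `i`-th one is `t^(1-n) a x_(n+1-i)`. -/
noncomputable def scaledReversal (n : ℕ) : Fin n → MvPolynomial (Fin n) K :=
  fun i => MvPolynomial.C (algebraMap F K (t ^ (1 - (n : ℤ))) * a) * MvPolynomial.X i.rev

/-- The defining properties of the interpolation `O`-polynomial: total degree at most `|α|`,
and its value at `β̄⁻¹` is `G_β(a α̃) / G_β(aτ)` for every composition `β`. -/
structure IsO (α : Fin n → ℕ) (p : MvPolynomial (Fin n) K) : Prop where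
  totalDegree_le : p.totalDegree ≤ size α
  eval_eq : ∀ β : Fin n → ℕ,
    MvPolynomial.eval (fun i => algebraMap F K (bar (toInt β) i)⁻¹) p =
      MvPolynomial.aeval (aMul (tilde (toInt α))) (G β) / GatTau β

/-- The interpolation `O`-polynomial `O_α(x; q, t; a)`: the polynomial with the defining
properties above. -/
noncomputable def O (α : Fin n → ℕ) : MvPolynomial (Fin n) K :=
  Classical.epsilon (IsO α)

end InterpolationMacdonald

namespace InterpolationMacdonald

open MvPolynomial

/-! Since `k_i(-w₀v)` and `k_{n+1-i}(v)` add up to `n - 1`, the map `x ↦ t^(1-n) a w₀x` sends `β̄⁻¹`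
to `aβ̃`. Hence `K_α(t^(1-n) a w₀x)` takes the value `K_α(aβ̃)` at `β̄⁻¹`, and the formula for `O_α`
is the duality `K_α(aβ̃) = K_β(aα̃)` (`normValue_comm`). Uniqueness of `O_α` holds because the
points `β̄⁻¹` contain arbitrarily large product grids (`eq_zero_of_eval_inv_bar`).

Existence and uniqueness of `G_α` come from a determinant over `ℚ[q, t]` that is nonzero already at
`q = 2`, `t = 1`. Consequently a polynomial of degree at most `|α|` with the zeros of `G_α` is a
multiple of it (`eq_C_mul_G`). This shows that the raising operator `Φ` sends `G_u` to a multiple of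
`G_{raise u}`, and that `Hᵢ G_u` is a combination of `G_u` and `G_{sᵢu}`.

Evaluating these identities at `aτ` and at `aṽ` and eliminating the unknown constants gives
relations between normalized values (`eigenFactor_mul_normValue_raise`, `normValue_swap`), whose
form is preserved by exchanging `u` and `v`. Every composition arises from `0` by raising and
adjacent swaps, so duality and `G_α(aτ) ≠ 0` follow by induction. The value of `Φ G_u` at `aτ` comes
from the eigenvalue equation `G_add_heckeChain_phi_G`, as each `Hᵢ` acts at `aτ` by the scalar `t`.
-/

theorem kNum_le {n : ℕ} (v : Fin n → ℤ) (i : Fin n) : kNum v i ≤ n := by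
  classical
  unfold kNum
  rw [← Finset.card_union_of_disjoint]
  · exact (Finset.card_le_univ _).trans_eq (Fintype.card_fin n)
  · rw [Finset.disjoint_filter]
    intro k _ h1 h2
    exact lt_asymm h1.1 h2.1

/-! ### Multiplicative independence of `q` and `t` -/

theorem q_ne_zero : q ≠ 0 := by
  unfold q
  rw [Ne, map_eq_zero_iff _ (IsFractionRing.injective _ _)]
  exact X_ne_zero _

theorem t_ne_zero : t ≠ 0 := by
  unfold t
  rw [Ne, map_eq_zero_iff _ (IsFractionRing.injective _ _)]
  exact X_ne_zero _

theorem pow_mul_pow_inj {r s r' s' : ℕ} (h : q ^ r * t ^ s = q ^ r' * t ^ s') :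
    r = r' ∧ s = s' := by
  unfold q t at h
  rw [← map_pow, ← map_pow, ← map_pow, ← map_pow, ← map_mul, ← map_mul] at h
  have h := IsFractionRing.injective (MvPolynomial (Fin 2) ℚ) F h
  have h1 := congrArg (eval ![2, 1]) h
  have h2 := congrArg (eval ![1, 2]) h
  simp only [map_mul, map_pow, eval_X, Matrix.cons_val_zero, Matrix.cons_val_one,
    one_pow, mul_one, one_mul] at h1 h2
  exact ⟨pow_right_injective₀ (by norm_num) (by norm_num) h1,
    pow_right_injective₀ (by norm_num) (by norm_num) h2⟩

theorem zpow_mul_zpow_eq_one {r s : ℤ} (h : q ^ r * t ^ s = 1) : r = 0 ∧ s = 0 := by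
  have e : q ^ r.toNat * t ^ s.toNat = q ^ (-r).toNat * t ^ (-s).toNat := by
    have hr : ((r.toNat : ℕ) : ℤ) = r + (-r).toNat := by omega
    have hs : ((s.toNat : ℕ) : ℤ) = s + (-s).toNat := by omega
    rw [← zpow_natCast q, ← zpow_natCast t, ← zpow_natCast q, ← zpow_natCast t, hr, hs,
      zpow_add₀ q_ne_zero, zpow_add₀ t_ne_zero]
    calc _ = (q ^ r * t ^ s) * (q ^ ((-r).toNat : ℤ) * t ^ ((-s).toNat : ℤ)) := by ring
      _ = _ := by rw [h, one_mul]
  have := pow_mul_pow_inj e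
  omega

theorem zpow_mul_zpow_inj {r s r' s' : ℤ} (h : q ^ r * t ^ s = q ^ r' * t ^ s') :
    r = r' ∧ s = s' := by
  have : q ^ (r - r') * t ^ (s - s') = 1 := by
    rw [zpow_sub₀ q_ne_zero, zpow_sub₀ t_ne_zero, div_mul_div_comm, h, div_self]
    exact mul_ne_zero (zpow_ne_zero _ q_ne_zero) (zpow_ne_zero _ t_ne_zero)
  have := zpow_mul_zpow_eq_one this
  omega

/-! ### Unique solvability of the interpolation problem -/

/-- The exponent of a composition, as a finitely supported function. -/
noncomputable abbrev expo {n : ℕ} (α : Fin n → ℕ) : Fin n →₀ ℕ :=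
  Finsupp.equivFunOnFinite.symm α

theorem degree_expo {n : ℕ} (α : Fin n → ℕ) : (expo α).degree = size α := by
  simp [Finsupp.degree_eq_sum, size]

/-- The interpolation problem at `q = 2`, `t = 1`, where `w̄` becomes `(2^{w_i})`. A monomial `m` of
top degree is outside `S`; the combinatorial Nullstellensatz gives `w ≤ m` with `g(2^w) ≠ 0`. Then
`w ∈ S` has size `d`, which forces `w = m`. -/
theorem eq_zero_of_grid {n d : ℕ} (S : Set (Fin n → ℕ)) (hS : ∀ w ∈ S, size w = d)
    (g : MvPolynomial (Fin n) ℚ) (hg : g.totalDegree ≤ d)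
    (h1 : ∀ w ∈ S, coeff (expo w) g = 0)
    (h2 : ∀ w, size w ≤ d → w ∉ S → eval (fun i => (2 : ℚ) ^ w i) g = 0) : g = 0 := by
  classical
  by_contra h0
  obtain ⟨m, hm, hmd⟩ := Finset.exists_mem_eq_sup g.support (support_nonempty.mpr h0)
    (fun s => s.sum fun _ e => e)
  have hdeg : g.totalDegree = m.degree := by
    rw [totalDegree, hmd]; rfl
  have hmS : (m : Fin n → ℕ) ∉ S := fun h => by
    have := h1 _ h
    rw [show expo (m : Fin n → ℕ) = m from by ext; simp] at this
    exact (mem_support_iff.mp hm) this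
  obtain ⟨s, hs, hne⟩ := combinatorial_nullstellensatz_exists_eval_nonzero g m
    (mem_support_iff.mp hm) hdeg
    (fun i => (Finset.range (m i + 1)).image fun j => (2 : ℚ) ^ j) (fun i => by
      rw [Finset.card_image_of_injective _ (pow_right_injective₀ (by norm_num) (by norm_num))]
      simp)
  have hs' : ∀ i, ∃ j ≤ m i, (2 : ℚ) ^ j = s i := fun i => by
    obtain ⟨j, hj, e⟩ := Finset.mem_image.mp (hs i)
    exact ⟨j, by simpa [Nat.lt_succ_iff] using hj, e⟩
  choose w hw hws using hs'
  have hsz : size w ≤ size m := Finset.sum_le_sum fun i _ => hw i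
  have hmd' : size m ≤ d := by
    rw [hdeg, Finsupp.degree_eq_sum] at hg
    exact hg
  have hwS : w ∈ S := by
    by_contra h
    refine hne ?_
    rw [← h2 w (hsz.trans hmd') h]
    congr 2
    ext i
    exact (hws i).symm
  have heq : w = m := by
    have hsum : ∑ i, w i = ∑ i, m i := le_antisymm hsz (hmd'.trans (hS w hwS).ge)
    ext i
    exact (Finset.sum_eq_sum_iff_of_le fun i _ => hw i).mp hsum i (Finset.mem_univ i)
  exact hmS (heq ▸ hwS)

theorem finite_size_le (n d : ℕ) : {w : Fin n → ℕ | size w ≤ d}.Finite := by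
  refine (Set.finite_Iic fun _ : Fin n => d).subset fun w hw i => ?_
  exact (Finset.single_le_sum (f := w) (fun _ _ => Nat.zero_le _) (Finset.mem_univ i)).trans hw

noncomputable instance (n d : ℕ) : Fintype {w : Fin n → ℕ // size w ≤ d} :=
  (finite_size_le n d).fintype

/-- The polynomial of degree at most `d` with given coefficients. -/
noncomputable def ofCoeffs {R : Type*} [CommSemiring R] {n d : ℕ}
    (c : {w : Fin n → ℕ // size w ≤ d} → R) : MvPolynomial (Fin n) R :=
  ∑ m, monomial (expo m.1) (c m)

theorem coeff_ofCoeffs {R : Type*} [CommSemiring R] {n d : ℕ}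
    (c : {w : Fin n → ℕ // size w ≤ d} → R) (m : {w : Fin n → ℕ // size w ≤ d}) :
    coeff (expo m.1) (ofCoeffs c) = c m := by
  classical
  simp [ofCoeffs, coeff_sum, coeff_monomial, Subtype.coe_inj]

theorem totalDegree_ofCoeffs_le {R : Type*} [CommSemiring R] {n d : ℕ}
    (c : {w : Fin n → ℕ // size w ≤ d} → R) : (ofCoeffs c).totalDegree ≤ d := by
  refine totalDegree_finsetSum_le fun m _ => (totalDegree_monomial_le _ _).trans ?_
  exact (degree_expo m.1).trans_le m.2

theorem ofCoeffs_coeff {R : Type*} [CommSemiring R] {n d : ℕ} {g : MvPolynomial (Fin n) R}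
    (hg : g.totalDegree ≤ d) :
    ofCoeffs (fun m : {w : Fin n → ℕ // size w ≤ d} => coeff (expo m.1) g) = g := by
  classical
  ext m
  by_cases hm : m.degree ≤ d
  · have := coeff_ofCoeffs (fun m : {w : Fin n → ℕ // size w ≤ d} => coeff (expo m.1) g)
      ⟨m, (by rw [← degree_expo]; simpa using hm)⟩
    simpa using this
  · have h : ∀ p : MvPolynomial (Fin n) R, p.totalDegree ≤ d → coeff m p = 0 := fun p hp =>
      coeff_eq_zero_of_totalDegree_lt (hp.trans_lt (not_le.mp hm))
    rw [h _ hg, h _ (totalDegree_ofCoeffs_le _)]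

theorem eval_ofCoeffs {R : Type*} [CommSemiring R] {n d : ℕ}
    (c : {w : Fin n → ℕ // size w ≤ d} → R) (x : Fin n → R) :
    eval x (ofCoeffs c) = ∑ m, (∏ i, x i ^ m.1 i) * c m := by
  simp only [ofCoeffs, map_sum, eval_monomial]
  refine Finset.sum_congr rfl fun m _ => ?_
  rw [mul_comm, Finsupp.prod_fintype _ _ (by simp)]
  simp

open Classical in
/-- The matrix over `ℚ[q, t]` of the conditions "coefficient of `x ^ w`" for `w ∈ S` and
"value at `w̄`" for `w ∉ S`, up to a power of `t`. -/
noncomputable def condMatrix (n d : ℕ) (S : Set (Fin n → ℕ)) :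
    Matrix {w : Fin n → ℕ // size w ≤ d} {w : Fin n → ℕ // size w ≤ d}
      (MvPolynomial (Fin 2) ℚ) :=
  fun w m => if w.1 ∈ S then (if m = w then X 1 ^ (n * d) else 0)
    else (∏ i, (X 0 ^ w.1 i * X 1 ^ (n - kNum (toInt w.1) i)) ^ m.1 i) *
      X 1 ^ (n * (d - size m.1))

open Classical in
theorem condMatrix_mulVec_rat {n d : ℕ} (S : Set (Fin n → ℕ))
    (c : {w : Fin n → ℕ // size w ≤ d} → ℚ) (w : {w : Fin n → ℕ // size w ≤ d}) :
    ((condMatrix n d S).map (eval ![2, 1])).mulVec c w =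
      if w.1 ∈ S then coeff (expo w.1) (ofCoeffs c)
        else eval (fun i => (2 : ℚ) ^ w.1 i) (ofCoeffs c) := by
  rw [coeff_ofCoeffs, eval_ofCoeffs, Matrix.mulVec, dotProduct]
  split_ifs with h
  · rw [Finset.sum_eq_single w (fun m _ hm => by simp [condMatrix, h, hm]) (by simp)]
    simp [condMatrix, h]
  · simp [condMatrix, h]

open Classical in
theorem condMatrix_mulVec {n d : ℕ} (S : Set (Fin n → ℕ))
    (c : {w : Fin n → ℕ // size w ≤ d} → F) (w : {w : Fin n → ℕ // size w ≤ d}) :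
    ((condMatrix n d S).map (algebraMap _ F)).mulVec c w =
      t ^ (n * d) * if w.1 ∈ S then coeff (expo w.1) (ofCoeffs c)
        else eval (bar (toInt w.1)) (ofCoeffs c) := by
  rw [coeff_ofCoeffs, eval_ofCoeffs, Matrix.mulVec, dotProduct]
  split_ifs with h
  · simp [condMatrix, h, apply_ite (algebraMap (MvPolynomial (Fin 2) ℚ) F), t]
  · rw [Finset.mul_sum]
    refine Finset.sum_congr rfl fun m _ => ?_
    simp only [condMatrix, h, Matrix.map_apply, if_false, map_mul, map_prod, map_pow]
    rw [← mul_assoc]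
    congr 1
    have e : ∀ i, q ^ w.1 i * t ^ (n - kNum (toInt w.1) i) = t ^ n * bar (toInt w.1) i := by
      intro i
      rw [bar, toInt, zpow_natCast, zpow_neg, zpow_natCast,
        pow_sub₀ _ t_ne_zero (kNum_le _ _)]
      change _ = t ^ n * (q ^ w.1 i * (t ^ kNum (toInt w.1) i)⁻¹)
      ring
    change (∏ i, (q ^ w.1 i * t ^ (n - kNum (toInt w.1) i)) ^ m.1 i) *
      t ^ (n * (d - size m.1)) = _
    simp only [e, mul_pow, Finset.prod_mul_distrib]
    rw [Finset.prod_pow_eq_pow_sum, ← pow_mul, mul_right_comm, ← pow_add, ← mul_add]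
    congr 3
    exact Nat.add_sub_cancel' m.2

/-- Scaling the rows by `t^(nd)` makes the entries polynomial, so the determinant can be specialized
to `q = 2`, `t = 1`, where a kernel vector would contradict `eq_zero_of_grid`. -/
theorem det_condMatrix_ne_zero {n d : ℕ} (S : Set (Fin n → ℕ)) (hS : ∀ w ∈ S, size w = d) :
    ((condMatrix n d S).map (algebraMap _ F)).det ≠ 0 := by
  classical
  have h0 : ((condMatrix n d S).map (eval ![(2 : ℚ), 1])).det ≠ 0 := by
    intro h
    obtain ⟨c, hc, hz⟩ := Matrix.exists_mulVec_eq_zero_iff.mpr h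
    refine hc ?_
    have hg : ofCoeffs c = 0 := by
      refine eq_zero_of_grid S hS _ (totalDegree_ofCoeffs_le c) (fun w hw => ?_)
        (fun w hw hwS => ?_)
      · have := congrFun hz ⟨w, (hS w hw).le⟩
        rw [condMatrix_mulVec_rat, if_pos hw] at this
        exact this
      · have := congrFun hz ⟨w, hw⟩
        rw [condMatrix_mulVec_rat, if_neg hwS] at this
        exact this
    ext m
    rw [← coeff_ofCoeffs c m, hg]
    rfl
  rw [← RingHom.mapMatrix_apply, ← RingHom.map_det] at h0 ⊢
  rw [Ne, map_eq_zero_iff _ (IsFractionRing.injective _ _)]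
  rintro h
  rw [h, map_zero] at h0
  exact h0 rfl

-- Used with `S = {α}` to define `G_α`, and with `S = ∅` to see that the values at all `w̄` with
-- `|w| ≤ d` determine a polynomial of degree at most `d`.
open Classical in
theorem existsUnique_of_conditions {n d : ℕ} (S : Set (Fin n → ℕ)) (hS : ∀ w ∈ S, size w = d)
    (y : (Fin n → ℕ) → F) :
    ∃! g : MvPolynomial (Fin n) F, g.totalDegree ≤ d ∧ ∀ w, size w ≤ d →
      (if w ∈ S then coeff (expo w) g else eval (bar (toInt w)) g) = y w := by
  have hu := (Matrix.isUnit_iff_isUnit_det _).mpr (isUnit_iff_ne_zero.mpr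
    (det_condMatrix_ne_zero S hS))
  have hbij := And.intro (Matrix.mulVec_injective_iff_isUnit.mpr hu)
    (Matrix.mulVec_surjective_iff_isUnit.mpr hu)
  have ht : t ^ (n * d) ≠ 0 := pow_ne_zero _ t_ne_zero
  obtain ⟨c, hc⟩ := hbij.2 fun w => t ^ (n * d) * y w.1
  refine ⟨ofCoeffs c, ⟨totalDegree_ofCoeffs_le c, fun w hw => ?_⟩, ?_⟩
  · have := congrFun hc ⟨w, hw⟩
    simp only [condMatrix_mulVec] at this
    exact mul_left_cancel₀ ht this
  · rintro g ⟨hg, hgy⟩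
    rw [← ofCoeffs_coeff hg]
    congr 1
    refine hbij.1 (hc ▸ funext fun w => ?_)
    rw [condMatrix_mulVec, ofCoeffs_coeff hg, hgy w.1 w.2]

theorem existsUnique_isInterpolation {n : ℕ} (α : Fin n → ℕ) :
    ∃! g : MvPolynomial (Fin n) F, IsInterpolation α g := by
  classical
  have key : ∀ g : MvPolynomial (Fin n) F, IsInterpolation α g ↔
      (g.totalDegree ≤ size α ∧ ∀ w, size w ≤ size α →
        (if w ∈ ({α} : Set (Fin n → ℕ)) then coeff (expo w) g else eval (bar (toInt w)) g) =
          if w = α then 1 else 0) := by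
    refine fun g => ⟨fun h => ⟨h.1, fun w hw => ?_⟩, fun h => ⟨h.1, fun w hw hne => ?_, ?_⟩⟩
    · by_cases e : w = α
      · simpa [e] using h.3
      · simpa [e] using h.2 w hw e
    · simpa [hne] using h.2 w hw
    · simpa using h.2 α le_rfl
  simp only [key]
  convert existsUnique_of_conditions (d := size α) {α} (by simp) fun w => if w = α then 1 else 0

theorem G_spec {n : ℕ} (α : Fin n → ℕ) : IsInterpolation α (G α) :=
  Classical.epsilon_spec (existsUnique_isInterpolation α).exists

theorem eq_zero_of_eval_bar {n d : ℕ} (g : MvPolynomial (Fin n) F) (hg : g.totalDegree ≤ d)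
    (h : ∀ w : Fin n → ℕ, size w ≤ d → eval (bar (toInt w)) g = 0) : g = 0 := by
  classical
  refine (existsUnique_of_conditions (n := n) (d := d) ∅ (by simp) 0).unique
    ⟨hg, fun w hw => ?_⟩ ⟨by simp, fun w hw => by simp⟩
  simpa using h w hw

theorem eval_bar_G_ne_zero {n : ℕ} (α : Fin n → ℕ) : eval (bar (toInt α)) (G α) ≠ 0 := by
  intro h
  have h0 : G α = 0 := eq_zero_of_eval_bar _ (G_spec α).1 fun w hw => by
    by_cases e : w = α
    · rw [e, h]
    · exact (G_spec α).2 w hw e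
  have := (G_spec α).3
  simp [h0] at this

/-- A polynomial of degree at most `|α|` vanishing where `G_α` does is a multiple of `G_α`. -/
theorem eq_C_mul_G {n : ℕ} (α : Fin n → ℕ) (g : MvPolynomial (Fin n) F)
    (hg : g.totalDegree ≤ size α)
    (h : ∀ w, size w ≤ size α → w ≠ α → eval (bar (toInt w)) g = 0) :
    g = C (eval (bar (toInt α)) g / eval (bar (toInt α)) (G α)) * G α := by
  refine sub_eq_zero.mp (eq_zero_of_eval_bar (d := size α) _ ?_ fun w hw => ?_)
  · refine (totalDegree_sub _ _).trans (max_le hg ((totalDegree_mul _ _).trans ?_))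
    simpa using (G_spec α).1
  · by_cases e : w = α
    · simp [e, eval_bar_G_ne_zero]
    · simp [h w hw e, (G_spec α).2 w hw e]

/-! ### Combinatorics of the points `v̄` and `ṽ` -/

/-- A single rule: `k_i` is the number of positions before `i` in the total order by decreasing
value, ties broken from left to right. -/
theorem kNum_eq_sum {n : ℕ} (v : Fin n → ℤ) (i : Fin n) :
    kNum v i = ∑ k, if v i < v k ∨ (v k = v i ∧ k < i) then 1 else 0 := by
  unfold kNum
  rw [Finset.card_filter, Finset.card_filter, ← Finset.sum_add_distrib]
  refine Finset.sum_congr rfl fun k _ => ?_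
  split_ifs <;> first | rfl | grind

/-- The map `(u₁, …, uₙ) ↦ (u₂, …, uₙ, u₁ + 1)`. -/
def raise {A : Type*} [Add A] [One A] {m : ℕ} (u : Fin (m + 1) → A) : Fin (m + 1) → A :=
  Fin.snoc (α := fun _ => A) (Fin.tail u) (u 0 + 1)

section raise

variable {A : Type*} [Add A] [One A] {m : ℕ} (u : Fin (m + 1) → A)

@[simp] theorem raise_last : raise u (Fin.last m) = u 0 + 1 := by simp [raise]

@[simp] theorem raise_castSucc (i : Fin m) : raise u i.castSucc = u i.succ := by
  simp [raise, Fin.tail]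

end raise

theorem toInt_raise {m : ℕ} (u : Fin (m + 1) → ℕ) : toInt (raise u) = raise (toInt u) := by
  ext i
  refine Fin.lastCases ?_ (fun i => ?_) i <;> simp [toInt]

theorem size_raise {m : ℕ} (u : Fin (m + 1) → ℕ) : size (raise u) = size u + 1 := by
  rw [size, size, Fin.sum_univ_castSucc, Fin.sum_univ_succ]
  simp only [raise_last, raise_castSucc]
  omega

theorem kNum_raise_last {m : ℕ} (v : Fin (m + 1) → ℤ) :
    kNum (raise v) (Fin.last m) = kNum v 0 := by
  rw [kNum_eq_sum, kNum_eq_sum, Fin.sum_univ_castSucc, Fin.sum_univ_succ]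
  simp only [raise_last, raise_castSucc, lt_irrefl, and_false, or_false, if_false, add_zero,
    Fin.castSucc_lt_last, and_true, Fin.not_lt_zero, zero_add]
  refine Finset.sum_congr rfl fun k _ => if_congr ?_ rfl rfl
  omega

theorem kNum_raise_castSucc {m : ℕ} (v : Fin (m + 1) → ℤ) (i : Fin m) :
    kNum (raise v) i.castSucc = kNum v i.succ := by
  rw [kNum_eq_sum, kNum_eq_sum, Fin.sum_univ_castSucc, Fin.sum_univ_succ, add_comm]
  simp only [raise_last, raise_castSucc, Fin.castSucc_lt_castSucc_iff, Fin.succ_lt_succ_iff,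
    Fin.succ_pos, and_true]
  congr 1
  refine if_congr ?_ rfl rfl
  have : ¬ Fin.last m < i.castSucc := (Fin.castSucc_lt_last i).not_gt
  simp only [this, and_false, or_false]
  omega

theorem bar_raise_last {m : ℕ} (v : Fin (m + 1) → ℤ) :
    bar (raise v) (Fin.last m) = q * bar v 0 := by
  rw [bar, bar, kNum_raise_last, raise_last, zpow_add₀ q_ne_zero, zpow_one]
  ring

theorem bar_raise_castSucc {m : ℕ} (v : Fin (m + 1) → ℤ) (i : Fin m) :
    bar (raise v) i.castSucc = bar v i.succ := by
  rw [bar, bar, kNum_raise_castSucc, raise_castSucc]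

/-- The transposition of two adjacent positions. -/
abbrev adj {m : ℕ} (i : Fin m) : Equiv.Perm (Fin (m + 1)) := Equiv.swap i.castSucc i.succ

theorem adj_lt_adj {m : ℕ} (i : Fin m) {j k : Fin (m + 1)}
    (h : ¬ (j = i.castSucc ∧ k = i.succ)) (hjk : j < k) : adj i j < adj i k := by
  simp only [adj, Equiv.swap_apply_def]
  split_ifs <;>
    simp only [Fin.lt_def, Fin.ext_iff, Fin.val_succ, Fin.val_castSucc] at * <;> omega

/-- An adjacent swap alters the left-to-right order only of the two swapped positions, and these are
not tied. -/
theorem kNum_comp_adj {m : ℕ} (v : Fin (m + 1) → ℤ) (i : Fin m)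
    (hv : v i.castSucc ≠ v i.succ) (j : Fin (m + 1)) :
    kNum (v ∘ adj i) j = kNum v (adj i j) := by
  rw [kNum_eq_sum, kNum_eq_sum v, ← Equiv.sum_comp (adj i)
    (fun k => if v (adj i j) < v k ∨ (v k = v (adj i j) ∧ k < adj i j) then 1 else 0)]
  refine Finset.sum_congr rfl fun k _ => if_congr ?_ rfl rfl
  have hne : ∀ j k, v (adj i j) = v (adj i k) → ¬ (j = i.castSucc ∧ k = i.succ) := by
    rintro j k e ⟨rfl, rfl⟩
    simp only [adj, Equiv.swap_apply_left, Equiv.swap_apply_right] at e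
    exact hv e.symm
  refine or_congr Iff.rfl (and_congr_right fun hkj => ⟨adj_lt_adj i (hne _ _ hkj), fun h => ?_⟩)
  rcases lt_trichotomy k j with hlt | rfl | hlt
  · exact hlt
  · exact absurd h (lt_irrefl _)
  · exact absurd (adj_lt_adj i (hne _ _ hkj.symm) hlt) h.not_gt

theorem bar_comp_adj {m : ℕ} (v : Fin (m + 1) → ℤ) (i : Fin m)
    (hv : v i.castSucc ≠ v i.succ) : bar (v ∘ adj i) = bar v ∘ adj i := by
  ext j
  simp only [bar, kNum_comp_adj v i hv, Function.comp]

theorem bar_castSucc_of_eq {m : ℕ} (v : Fin (m + 1) → ℤ) (i : Fin m)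
    (hv : v i.castSucc = v i.succ) : bar v i.castSucc = t * bar v i.succ := by
  have : kNum v i.succ = kNum v i.castSucc + 1 := by
    rw [kNum_eq_sum, kNum_eq_sum,
      ← Finset.sum_erase_add _ _ (Finset.mem_univ i.castSucc),
      ← Finset.sum_erase_add _ _ (Finset.mem_univ i.castSucc)]
    simp only [hv, lt_irrefl, Fin.castSucc_lt_succ, and_false, or_false, if_false, true_and,
      false_or, if_true, add_zero]
    refine congrArg (· + 1) (Finset.sum_congr rfl fun k hk => if_congr ?_ rfl rfl)
    have : k ≠ i.castSucc := Finset.ne_of_mem_erase hk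
    have : k < i.succ ↔ k < i.castSucc := by
      simp only [Fin.lt_def, Ne, Fin.ext_iff, Fin.val_succ, Fin.val_castSucc] at this ⊢
      omega
    rw [this]
  rw [bar, bar, hv, this]
  push_cast
  rw [neg_add, zpow_add₀ t_ne_zero, zpow_neg_one]
  field_simp [t_ne_zero]

theorem bar_ne_mul {m : ℕ} (v : Fin m → ℤ) {i j : Fin m} (hv : v i ≠ v j) (r : ℤ) :
    bar v i ≠ t ^ r * bar v j := by
  intro h
  rw [bar, bar, mul_left_comm, ← zpow_add₀ t_ne_zero] at h
  exact hv (zpow_mul_zpow_inj h).1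

theorem bar_ne_zero {n : ℕ} (v : Fin n → ℤ) (i : Fin n) : bar v i ≠ 0 :=
  mul_ne_zero (zpow_ne_zero _ q_ne_zero) (zpow_ne_zero _ t_ne_zero)

theorem t_ne_one : t ≠ 1 := fun h => by
  have := zpow_mul_zpow_eq_one (r := 0) (s := 1) (by simpa using h)
  omega

theorem bar_castSucc_ne_succ {m : ℕ} (v : Fin (m + 1) → ℤ) (i : Fin m) :
    bar v i.castSucc ≠ bar v i.succ := by
  by_cases hv : v i.castSucc = v i.succ
  · rw [bar_castSucc_of_eq v i hv]
    exact fun h => t_ne_one (mul_right_cancel₀ (bar_ne_zero v i.succ) (h.trans (one_mul _).symm))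
  · simpa using bar_ne_mul v hv 0

/-- Negating and reversing turns the ranking around, so the two numbers count the positions after
and before `i.rev`, that is, all the others. -/
theorem kNum_neg_w0 {n : ℕ} (v : Fin n → ℤ) (i : Fin n) :
    kNum (-w0 v) i + kNum v i.rev + 1 = n := by
  have h1 : kNum (-w0 v) i = ∑ k, if v k < v i.rev ∨ (v k = v i.rev ∧ i.rev < k) then 1 else 0 := by
    rw [kNum_eq_sum, ← Equiv.sum_comp Fin.revPerm]
    refine Finset.sum_congr rfl fun k _ => if_congr ?_ rfl rfl
    simp only [w0, Pi.neg_apply, neg_lt_neg_iff, neg_inj, Fin.revPerm_apply, Fin.rev_rev,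
      Fin.rev_lt_iff]
  rw [h1, kNum_eq_sum, ← Finset.sum_add_distrib]
  have h2 : ∀ k, ((if v k < v i.rev ∨ (v k = v i.rev ∧ i.rev < k) then 1 else 0) +
      if v i.rev < v k ∨ (v k = v i.rev ∧ k < i.rev) then 1 else 0) =
      if k = i.rev then 0 else 1 := by
    intro k
    split_ifs <;> grind
  simp only [h2]
  rw [← Finset.sum_erase_add _ _ (Finset.mem_univ i.rev), if_pos rfl,
    Finset.sum_congr rfl (fun k hk => if_neg (Finset.ne_of_mem_erase hk))]
  have := i.pos
  simp
  omega

theorem tilde_eq {n : ℕ} (v : Fin n → ℤ) (i : Fin n) :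
    tilde v i = t ^ (1 - (n : ℤ)) * (bar v i.rev)⁻¹ := by
  have h := kNum_neg_w0 v i
  have h' : -(kNum (-w0 v) i : ℤ) = (1 - (n : ℤ)) + kNum v i.rev := by omega
  rw [tilde, bar, bar, h', zpow_add₀ t_ne_zero, mul_inv, ← zpow_neg, ← zpow_neg, neg_neg]
  simp only [w0, Pi.neg_apply]
  ring

theorem kNum_zero {n : ℕ} (i : Fin n) : kNum (0 : Fin n → ℤ) i = i := by
  have : (Finset.univ.filter fun k : Fin n => k < i) = Finset.Iio i := by ext; simp
  simp [kNum, this]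

theorem bar_zero {n : ℕ} : bar (0 : Fin n → ℤ) = tau := by
  ext i
  simp [bar, tau, kNum_zero]

theorem tilde_zero {n : ℕ} : tilde (0 : Fin n → ℤ) = tau := by
  rw [tilde, show -w0 (0 : Fin n → ℤ) = 0 from by ext; simp [w0], bar_zero]

theorem eq_raise_of_last_ne_zero {m : ℕ} {u : Fin (m + 1) → ℕ} (h : u (Fin.last m) ≠ 0) :
    ∃ u', u = raise u' := by
  refine ⟨Fin.cons (u (Fin.last m) - 1) (Fin.init u), ?_⟩
  ext k
  refine Fin.lastCases ?_ (fun k => ?_) k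
  · simp; omega
  · simp [Fin.init]

theorem size_comp_adj {m : ℕ} (w : Fin (m + 1) → ℕ) (i : Fin m) : size (w ∘ adj i) = size w :=
  Equiv.sum_comp (adj i) w

theorem comp_adj_comp_adj {m : ℕ} {A : Type*} (w : Fin (m + 1) → A) (i : Fin m) :
    (w ∘ adj i) ∘ adj i = w := by
  ext; simp [adj]

/-- Induction over compositions along `raise` and adjacent transpositions. -/
theorem composition_induction {m : ℕ} {P : (Fin (m + 1) → ℕ) → Prop} (zero : P 0)
    (raise : ∀ u, P u → P (raise u)) (swap : ∀ u (i : Fin m), P u → P (u ∘ adj i))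
    (u : Fin (m + 1) → ℕ) : P u := by
  -- `j` is the distance of a nonzero entry from the end: swaps carry the entry there, and a nonzero
  -- last entry allows `raise` to be undone, lowering the size.
  have last : ∀ d, ∀ j : ℕ, ∀ u : Fin (m + 1) → ℕ, size u = d → ∀ i : Fin (m + 1),
      (i : ℕ) + j = m → u i ≠ 0 → (∀ u', size u' < d → P u') → P u := by
    intro d j
    induction j with
    | zero =>
      intro u hd i hi hu ih
      obtain rfl : i = Fin.last m := by ext; simpa using hi
      obtain ⟨u, rfl⟩ := eq_raise_of_last_ne_zero hu
      rw [size_raise] at hd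
      exact raise _ (ih _ (by omega))
    | succ j ih' =>
      intro u hd i hi hu ih
      obtain ⟨k, rfl⟩ : ∃ k : Fin m, i = k.castSucc := ⟨⟨i, by omega⟩, rfl⟩
      have := swap _ k (ih' (u ∘ adj k) ((size_comp_adj u k).trans hd) k.succ
        (by simp at hi ⊢; omega) (by simpa [adj] using hu) ih)
      rwa [comp_adj_comp_adj] at this
  have main : ∀ d, ∀ u : Fin (m + 1) → ℕ, size u = d → P u := by
    intro d
    induction d using Nat.strong_induction_on with
    | _ d ih =>
      intro u hd
      by_cases h : u = 0
      · exact h ▸ zero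
      · obtain ⟨i, hi⟩ := Function.ne_iff.mp h
        exact last d (m - i) u hd i (by omega) hi fun u' hu' => ih _ hu' u' rfl
  exact main _ u rfl

/-! ### Demazure–Lusztig operators -/

theorem dvd_aeval_sub_aeval {σ R A : Type*} [CommRing R] [CommRing A] [Algebra R A] {d : A}
    {x y : σ → A} (h : ∀ i, d ∣ x i - y i) (p : MvPolynomial σ R) :
    d ∣ aeval x p - aeval y p := by
  induction p using MvPolynomial.induction_on with
  | C r => simp
  | add p₁ p₂ h₁ h₂ =>
    rw [map_add, map_add, add_sub_add_comm]
    exact dvd_add h₁ h₂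
  | mul_X p i hp =>
    rw [map_mul, map_mul, aeval_X, aeval_X]
    have : aeval x p * x i - aeval y p * y i =
      (aeval x p - aeval y p) * x i + aeval y p * (x i - y i) := by ring
    rw [this]
    exact dvd_add (hp.mul_right _) ((h i).mul_left _)

theorem totalDegree_aeval_le {σ τ R : Type*} [CommRing R] (g : σ → MvPolynomial τ R)
    (hg : ∀ i, (g i).totalDegree ≤ 1) (p : MvPolynomial σ R) :
    (aeval g p).totalDegree ≤ p.totalDegree := by
  rw [aeval_def, eval₂_eq]
  refine totalDegree_finsetSum_le fun d hd => ?_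
  refine (totalDegree_mul _ _).trans ?_
  rw [algebraMap_eq, totalDegree_C, zero_add]
  refine (totalDegree_finsetProd _ _).trans ((Finset.sum_le_sum fun i _ => ?_).trans
    (le_totalDegree hd))
  exact (totalDegree_pow _ _).trans (by simpa using Nat.mul_le_mul_left (d i) (hg i))

theorem totalDegree_add_one_of_linear {σ R : Type*} [CommRing R] [IsDomain R]
    {l g f : MvPolynomial σ R} (hl : l.totalDegree = 1) (h : l * g = f) :
    g = 0 ∨ f.totalDegree = g.totalDegree + 1 := by
  by_cases hg : g = 0
  · exact Or.inl hg
  · have hl0 : l ≠ 0 := by rintro rfl; simp at hl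
    rw [← h, totalDegree_mul_of_isDomain hl0 hg, hl, add_comm]
    exact Or.inr rfl

theorem totalDegree_X_sub_X {σ R : Type*} [CommRing R] [Nontrivial R] {i j : σ} (h : i ≠ j) :
    (X i - X j : MvPolynomial σ R).totalDegree = 1 := by
  classical
  refine le_antisymm ((totalDegree_sub _ _).trans (by simp)) ?_
  have := le_totalDegree (p := (X i - X j : MvPolynomial σ R)) (s := Finsupp.single i 1) (by
    rw [mem_support_iff, coeff_sub, coeff_X, coeff_X, if_pos rfl, if_neg, sub_zero]
    · exact one_ne_zero
    · intro e
      rw [Finsupp.single_left_inj one_ne_zero] at e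
      exact h e.symm)
  simpa using this

variable {m : ℕ}

theorem dvd_sub_rename_adj (i : Fin m) (f : MvPolynomial (Fin (m + 1)) F) :
    X i.castSucc - X i.succ ∣ f - rename (adj i) f := by
  have := dvd_aeval_sub_aeval (R := F) (d := (X i.castSucc - X i.succ))
    (x := (X : Fin (m + 1) → MvPolynomial (Fin (m + 1)) F)) (y := fun k => X (adj i k))
    (fun k => by
      by_cases h1 : k = i.castSucc
      · simp [h1, adj]
      by_cases h2 : k = i.succ
      · rw [h2, adj, Equiv.swap_apply_right]
        exact ⟨-1, by ring⟩
      · simp [adj, Equiv.swap_apply_of_ne_of_ne h1 h2]) f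
  have e : aeval (fun k => X (adj i k) : Fin (m + 1) → MvPolynomial (Fin (m + 1)) F) f =
      rename (adj i) f := by
    rw [← aeval_X_left_apply (rename (adj i) f), aeval_rename]
    rfl
  rwa [aeval_X_left_apply, e] at this

/-- The divided difference `(f - sᵢ f) / (xᵢ - xᵢ₊₁)`. -/
noncomputable def divDiff (i : Fin m) (f : MvPolynomial (Fin (m + 1)) F) :
    MvPolynomial (Fin (m + 1)) F :=
  (dvd_sub_rename_adj i f).choose

theorem sub_mul_divDiff (i : Fin m) (f : MvPolynomial (Fin (m + 1)) F) :
    (X i.castSucc - X i.succ) * divDiff i f = f - rename (adj i) f :=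
  (dvd_sub_rename_adj i f).choose_spec.symm

/-- The Demazure–Lusztig operator `Hᵢ`. -/
noncomputable def hecke (i : Fin m) (f : MvPolynomial (Fin (m + 1)) F) :
    MvPolynomial (Fin (m + 1)) F :=
  C t * rename (adj i) f + C (t - 1) * X i.castSucc * divDiff i f

theorem totalDegree_hecke_le (i : Fin m) (f : MvPolynomial (Fin (m + 1)) F) :
    (hecke i f).totalDegree ≤ f.totalDegree := by
  have h1 : (rename (adj i) f).totalDegree ≤ f.totalDegree := totalDegree_rename_le _ _
  refine (totalDegree_add _ _).trans (max_le ?_ ?_)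
  · refine (totalDegree_mul _ _).trans ?_
    simpa using h1
  · rcases totalDegree_add_one_of_linear (totalDegree_X_sub_X (i.castSucc_lt_succ.ne))
      (sub_mul_divDiff i f) with h | h
    · simp [h]
    · refine (totalDegree_mul _ _).trans ?_
      have h2 : (C (t - 1) * X i.castSucc : MvPolynomial (Fin (m + 1)) F).totalDegree ≤ 1 :=
        (totalDegree_mul _ _).trans (by rw [totalDegree_C, totalDegree_X])
      have h3 := (totalDegree_sub f (rename (adj i) f)).trans (max_le le_rfl h1)
      omega

theorem aeval_hecke {L : Type*} [Field L] [Algebra F L] (x : Fin (m + 1) → L) (i : Fin m)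
    (hx : x i.castSucc ≠ x i.succ) (f : MvPolynomial (Fin (m + 1)) F) :
    aeval x (hecke i f) =
      (algebraMap F L t - 1) * x i.castSucc / (x i.castSucc - x i.succ) * aeval x f +
      (algebraMap F L t - (algebraMap F L t - 1) * x i.castSucc / (x i.castSucc - x i.succ)) *
        aeval (x ∘ adj i) f := by
  have h := congrArg (aeval x) (sub_mul_divDiff i f)
  simp only [map_mul, map_sub, aeval_X, aeval_rename] at h
  have hx' := sub_ne_zero.mpr hx
  simp only [hecke, map_add, map_mul, map_sub, aeval_X, aeval_C, aeval_rename, map_one]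
  have e : aeval x (divDiff i f) =
      (aeval x f - aeval (x ∘ adj i) f) / (x i.castSucc - x i.succ) := by
    rw [← h, mul_div_cancel_left₀ _ hx']
  rw [e]
  field_simp
  ring

/-- The diagonal coefficient of `Hᵢ` at the point `v̄`. -/
noncomputable def heckeCoeff (v : Fin (m + 1) → ℤ) (i : Fin m) : F :=
  (t - 1) * bar v i.castSucc / (bar v i.castSucc - bar v i.succ)

theorem t_sub_heckeCoeff_eq_zero (v : Fin (m + 1) → ℤ) (i : Fin m)
    (hv : v i.castSucc = v i.succ) : t - heckeCoeff v i = 0 := by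
  have h := sub_ne_zero.mpr (bar_castSucc_ne_succ v i)
  rw [heckeCoeff, sub_eq_zero, eq_div_iff h, bar_castSucc_of_eq v i hv]
  ring

theorem t_sub_heckeCoeff_ne_zero (v : Fin (m + 1) → ℤ) (i : Fin m)
    (hv : v i.castSucc ≠ v i.succ) : t - heckeCoeff v i ≠ 0 := by
  have h := sub_ne_zero.mpr (bar_castSucc_ne_succ v i)
  rw [heckeCoeff, Ne, sub_eq_zero, eq_div_iff h]
  intro e
  refine bar_ne_mul v hv 1 ?_
  rw [zpow_one]
  linear_combination e

/-- The multiple `s y` of a point `y`. -/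
noncomputable abbrev scale {L : Type*} [Field L] [Algebra F L] {n : ℕ} (s : L)
    (y : Fin n → F) : Fin n → L := fun i => s * algebraMap F L (y i)

theorem aeval_scale_one {n : ℕ} (y : Fin n → F) (f : MvPolynomial (Fin n) F) :
    aeval (scale (1 : F) y) f = eval y f := by
  rw [aeval_eq_eval]
  have : scale (1 : F) y = y := funext fun i => one_mul (y i)
  rw [this]

/-- The coefficients of `Hᵢ` are homogeneous of degree `0`, so `s` drops out. If `v_i = v_{i+1}`,
the swapped point need not be of the form `v̄`, but its coefficient vanishes. -/
theorem aeval_scale_bar_hecke {L : Type*} [Field L] [Algebra F L] {s : L} (hs : s ≠ 0)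
    (v : Fin (m + 1) → ℤ) (i : Fin m)
    (f : MvPolynomial (Fin (m + 1)) F) :
    aeval (scale s (bar v)) (hecke i f) =
      algebraMap F L (heckeCoeff v i) * aeval (scale s (bar v)) f +
      algebraMap F L (t - heckeCoeff v i) * aeval (scale s (bar (v ∘ adj i))) f := by
  have hb := bar_castSucc_ne_succ v i
  have hb' : scale s (bar v) i.castSucc ≠ scale s (bar v) i.succ := fun h =>
    hb ((algebraMap F L).injective (mul_left_cancel₀ hs h))
  have hc : (algebraMap F L t - 1) * scale s (bar v) i.castSucc /
      (scale s (bar v) i.castSucc - scale s (bar v) i.succ) =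
      algebraMap F L (heckeCoeff v i) := by
    simp only [heckeCoeff, scale, map_div₀, map_mul, map_sub, map_one]
    rw [← mul_sub, mul_left_comm, mul_div_mul_left _ _ hs]
  rw [aeval_hecke _ i hb', hc, map_sub]
  by_cases hv : v i.castSucc = v i.succ
  · have := congrArg (algebraMap F L) (t_sub_heckeCoeff_eq_zero v i hv)
    rw [map_sub, map_zero] at this
    rw [this, zero_mul, zero_mul]
  · rw [bar_comp_adj v i hv]
    rfl

theorem comp_adj_eq_self {A : Type*} {w : Fin (m + 1) → A} {i : Fin m}
    (h : w i.castSucc = w i.succ) : w ∘ adj i = w := by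
  ext k
  simp only [Function.comp, adj, Equiv.swap_apply_def]
  split_ifs <;> simp_all

theorem eval_bar_hecke (w : Fin (m + 1) → ℕ) (i : Fin m)
    (f : MvPolynomial (Fin (m + 1)) F) :
    eval (bar (toInt w)) (hecke i f) =
      heckeCoeff (toInt w) i * eval (bar (toInt w)) f +
      (t - heckeCoeff (toInt w) i) * eval (bar (toInt (w ∘ adj i))) f := by
  simp only [← aeval_scale_one]
  exact aeval_scale_bar_hecke one_ne_zero (toInt w) i f

/-- After the diagonal term is subtracted, the value at `w̄` is a multiple of `G_u` at the swapped
point, so only `w = sᵢu` can survive. The constant is never computed; it is eliminated through the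
value at `aτ`. -/
theorem exists_hecke_G_eq (u : Fin (m + 1) → ℕ) (i : Fin m) :
    ∃ κ : F, hecke i (G u) = C (heckeCoeff (toInt u) i) * G u + C κ * G (u ∘ adj i) := by
  refine ⟨_, eq_add_of_sub_eq' (eq_C_mul_G (u ∘ adj i) _ ?_ fun w hw hne => ?_)⟩
  · rw [size_comp_adj]
    refine (totalDegree_sub _ _).trans (max_le ((totalDegree_hecke_le _ _).trans (G_spec u).1)
      ((totalDegree_mul _ _).trans ?_))
    simpa using (G_spec u).1
  · rw [size_comp_adj] at hw
    rw [map_sub, eval_bar_hecke, map_mul, eval_C, add_sub_right_comm, ← sub_mul]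
    have h1 : (heckeCoeff (toInt w) i - heckeCoeff (toInt u) i) *
        eval (bar (toInt w)) (G u) = 0 := by
      by_cases e : w = u
      · rw [e, sub_self, zero_mul]
      · rw [(G_spec u).2 w hw e, mul_zero]
    rw [h1, zero_add, (G_spec u).2 _ (by rwa [size_comp_adj]), mul_zero]
    rintro rfl
    exact hne (comp_adj_comp_adj w i).symm

/-! ### The raising operator -/

/-- The point `(xₙ / q, x₁, …, xₙ₋₁)`. -/
noncomputable def shiftPoint {L : Type*} [Field L] [Algebra F L] (x : Fin (m + 1) → L) :
    Fin (m + 1) → L :=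
  Fin.cons (algebraMap F L q⁻¹ * x (Fin.last m)) (Fin.init x)

/-- The operator `Φ f(x) = (xₙ - t^(1-n)) f(xₙ / q, x₁, …, xₙ₋₁)`. -/
noncomputable def phi (f : MvPolynomial (Fin (m + 1)) F) : MvPolynomial (Fin (m + 1)) F :=
  (X (Fin.last m) - C (t ^ (-(m : ℤ)))) *
    aeval (Fin.cons (C q⁻¹ * X (Fin.last m)) (fun i : Fin m => X i.castSucc) :
      Fin (m + 1) → MvPolynomial (Fin (m + 1)) F) f

theorem aeval_phi {L : Type*} [Field L] [Algebra F L] (x : Fin (m + 1) → L)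
    (f : MvPolynomial (Fin (m + 1)) F) :
    aeval x (phi f) =
      (x (Fin.last m) - algebraMap F L (t ^ (-(m : ℤ)))) * aeval (shiftPoint x) f := by
  rw [phi, map_mul, map_sub, aeval_X, aeval_C]
  congr 1
  rw [← AlgHom.comp_apply]
  congr 1
  refine algHom_ext fun i => ?_
  refine Fin.cases ?_ (fun i => ?_) i <;> simp [shiftPoint, Fin.init]

theorem totalDegree_phi_le (f : MvPolynomial (Fin (m + 1)) F) :
    (phi f).totalDegree ≤ f.totalDegree + 1 := by
  refine (totalDegree_mul _ _).trans ?_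
  rw [add_comm]
  refine add_le_add (totalDegree_aeval_le _ (fun i => ?_) f)
    ((totalDegree_sub _ _).trans (by simp))
  refine Fin.cases ?_ (fun i => ?_) i
  · exact (totalDegree_mul _ _).trans (by simp)
  · simp

theorem shiftPoint_scale_bar_raise {L : Type*} [Field L] [Algebra F L] (s : L)
    (v : Fin (m + 1) → ℤ) : shiftPoint (scale s (bar (raise v))) = scale s (bar v) := by
  ext i
  refine Fin.cases ?_ (fun i => ?_) i
  · simp only [shiftPoint, Fin.cons_zero, scale, bar_raise_last]
    rw [mul_left_comm, ← map_mul, inv_mul_cancel_left₀ q_ne_zero]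
  · simp only [shiftPoint, Fin.cons_succ, Fin.init, scale, bar_raise_castSucc]

theorem bar_last_of_eq_zero (w : Fin (m + 1) → ℕ) (h : w (Fin.last m) = 0) :
    bar (toInt w) (Fin.last m) = t ^ (-(m : ℤ)) := by
  have : kNum (toInt w) (Fin.last m) = m := by
    rw [kNum_eq_sum, Fin.sum_univ_castSucc]
    have : ∀ k : Fin m, (toInt w (Fin.last m) < toInt w k.castSucc ∨
        (toInt w k.castSucc = toInt w (Fin.last m) ∧ k.castSucc < Fin.last m)) := fun k => by
      simp only [toInt, h, Fin.castSucc_lt_last, and_true]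
      omega
    rw [Finset.sum_congr rfl (fun k _ => if_pos (this k))]
    simp
  rw [bar, this]
  simp [toInt, h]

/-- If `w` ends in `0`, the linear factor of `Φ` vanishes at `w̄`; otherwise `w` is raised from some
`w'`, and the shifted point is the bar of `w'`. -/
theorem eval_bar_phi_G (u w : Fin (m + 1) → ℕ) (hw : size w ≤ size u + 1) (hne : w ≠ raise u) :
    eval (bar (toInt w)) (phi (G u)) = 0 := by
  rw [← aeval_scale_one, aeval_phi]
  by_cases h : w (Fin.last m) = 0
  · simp [scale, bar_last_of_eq_zero w h]
  · obtain ⟨w, rfl⟩ := eq_raise_of_last_ne_zero h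
    rw [toInt_raise, shiftPoint_scale_bar_raise, aeval_scale_one, (G_spec u).2, mul_zero]
    · rw [size_raise] at hw
      omega
    · rintro rfl
      exact hne rfl

theorem exists_phi_G_eq (u : Fin (m + 1) → ℕ) : ∃ c : F, phi (G u) = C c * G (raise u) := by
  refine ⟨_, eq_C_mul_G (raise u) _ ?_ fun w hw hne => ?_⟩
  · rw [size_raise]
    exact (totalDegree_phi_le _).trans (Nat.add_le_add_right (G_spec u).1 1)
  · rw [size_raise] at hw
    exact eval_bar_phi_G u w hw hne

/-! ### The eigenvalue equation -/

/-- The composite `Hⱼ Hⱼ₊₁ ⋯ Hₙ₋₁`. -/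
noncomputable def heckeChain (j : Fin (m + 1)) (f : MvPolynomial (Fin (m + 1)) F) :
    MvPolynomial (Fin (m + 1)) F :=
  Fin.reverseInduction (motive := fun _ => MvPolynomial (Fin (m + 1)) F) f
    (fun i g => hecke i g) j

@[simp] theorem heckeChain_last (f : MvPolynomial (Fin (m + 1)) F) :
    heckeChain (Fin.last m) f = f := by
  simp [heckeChain]

@[simp] theorem heckeChain_castSucc (i : Fin m) (f : MvPolynomial (Fin (m + 1)) F) :
    heckeChain i.castSucc f = hecke i (heckeChain i.succ f) := by
  simp [heckeChain]

theorem totalDegree_heckeChain_le (j : Fin (m + 1)) (f : MvPolynomial (Fin (m + 1)) F) :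
    (heckeChain j f).totalDegree ≤ f.totalDegree := by
  induction j using Fin.reverseInduction with
  | last => simp
  | cast i ih =>
    rw [heckeChain_castSucc]
    exact (totalDegree_hecke_le _ _).trans ih

theorem eval_bar_heckeChain_eq_zero {d : ℕ} {f : MvPolynomial (Fin (m + 1)) F}
    (hf : ∀ w, size w ≤ d → eval (bar (toInt w)) f = 0) (j : Fin (m + 1)) :
    ∀ w, size w ≤ d → eval (bar (toInt w)) (heckeChain j f) = 0 := by
  induction j using Fin.reverseInduction with
  | last => simpa using hf
  | cast i ih =>
    intro w hw
    rw [heckeChain_castSucc, eval_bar_hecke, ih w hw, ih _ ((size_comp_adj w i).trans_le hw)]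
    simp

theorem aeval_aMul_tau_hecke (i : Fin m) (f : MvPolynomial (Fin (m + 1)) F) :
    aeval (aMul tau) (hecke i f) = algebraMap F K t * aeval (aMul tau) f := by
  have h := aeval_scale_bar_hecke (L := K) (s := a) RatFunc.X_ne_zero 0 i f
  have h0 := t_sub_heckeCoeff_eq_zero (0 : Fin (m + 1) → ℤ) i rfl
  rw [h0, map_zero, zero_mul, add_zero, ← sub_eq_zero.mp h0, bar_zero] at h
  exact h

theorem aeval_aMul_tau_heckeChain (j : Fin (m + 1)) (f : MvPolynomial (Fin (m + 1)) F) :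
    aeval (aMul tau) (heckeChain j f) =
      algebraMap F K t ^ (m - (j : ℕ)) * aeval (aMul tau) f := by
  induction j using Fin.reverseInduction with
  | last => simp
  | cast i ih =>
    rw [heckeChain_castSucc, aeval_aMul_tau_hecke, ih, ← mul_assoc, ← pow_succ']
    congr 2
    simp only [Fin.val_succ, Fin.val_castSucc]
    omega

/-- The point obtained by moving the `j`-th coordinate to the end. -/
def moveToEnd {L : Type*} (j : Fin (m + 1)) (x : Fin (m + 1) → L) : Fin (m + 1) → L :=
  Fin.snoc (α := fun _ => L) (fun k => x (j.succAbove k)) (x j)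

theorem moveToEnd_last {L : Type*} (x : Fin (m + 1) → L) : moveToEnd (Fin.last m) x = x := by
  ext i
  refine Fin.lastCases ?_ (fun i => ?_) i <;> simp [moveToEnd]

theorem moveToEnd_succ_comp_adj {L : Type*} (i : Fin m) (x : Fin (m + 1) → L) :
    moveToEnd i.succ (x ∘ adj i) = moveToEnd i.castSucc x := by
  ext k
  refine Fin.lastCases ?_ (fun k => ?_) k
  · simp [moveToEnd, adj]
  · simp only [moveToEnd, Fin.snoc_castSucc, Function.comp]
    congr 1
    simp only [adj, Equiv.swap_apply_def, Fin.succAbove]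
    split_ifs <;> simp only [Fin.lt_def, Fin.ext_iff, Fin.val_succ, Fin.val_castSucc] at * <;>
      omega

theorem aeval_heckeChain_of_eq_zero {L : Type*} [Field L] [Algebra F L]
    (f : MvPolynomial (Fin (m + 1)) F) (j : Fin (m + 1)) :
    ∀ x : Fin (m + 1) → L, x j = 0 → (∀ k, k ≠ j → x k ≠ 0) →
      aeval x (heckeChain j f) = algebraMap F L t ^ (m - (j : ℕ)) * aeval (moveToEnd j x) f := by
  induction j using Fin.reverseInduction with
  | last => intro x _ _; simp [moveToEnd_last]
  | cast i ih =>
    intro x hx hne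
    have h1 : x i.castSucc ≠ x i.succ := by
      rw [hx]
      exact (hne _ i.castSucc_lt_succ.ne').symm
    rw [heckeChain_castSucc, aeval_hecke x i h1, hx, mul_zero, zero_div, zero_mul, zero_add,
      sub_zero, ih (x ∘ adj i) (by simp [adj, hx]), moveToEnd_succ_comp_adj, ← mul_assoc,
      ← pow_succ']
    · congr 2
      simp only [Fin.val_succ, Fin.val_castSucc]
      omega
    · intro k hk
      refine hne _ fun e => hk ?_
      rw [← (adj i).injective.eq_iff, e]
      simp [adj]

/-- On `x₁ = 0` each `Hᵢ` of the chain reduces to `t sᵢ`, so the zero travels to the last place.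
There `Φ` contributes `-t^(1-n)` and moves it back, which cancels `f`. -/
theorem X_zero_dvd (f : MvPolynomial (Fin (m + 1)) F) : X 0 ∣ f + heckeChain 0 (phi f) := by
  classical
  set p := f + heckeChain 0 (phi f) with hp
  let y : Fin (m + 1) → MvPolynomial (Fin (m + 1)) F := Function.update X 0 0
  have hdvd := dvd_aeval_sub_aeval (R := F) (d := X 0)
    (x := (X : Fin (m + 1) → MvPolynomial (Fin (m + 1)) F)) (y := y)
    (fun k => by
      by_cases h : k = 0
      · simp [h, y]
      · simp [y, Function.update_of_ne h]) p
  suffices h : aeval y p = 0 by rwa [h, sub_zero, aeval_X_left_apply] at hdvd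
  -- Generic values for the other coordinates keep them nonzero, so the denominators in the formula
  -- for `Hᵢ` do not vanish.
  let L := FractionRing (MvPolynomial (Fin (m + 1)) F)
  have hinj : Function.Injective (algebraMap (MvPolynomial (Fin (m + 1)) F) L) :=
    IsFractionRing.injective _ _
  let x : Fin (m + 1) → L := fun k => algebraMap _ L (y k)
  have hx : aeval x p = algebraMap _ L (aeval y p) := aeval_algebraMap_apply L y p
  refine hinj ?_
  rw [← hx, map_zero, hp, map_add]
  have hx0 : x 0 = 0 := by simp [x, y]
  rw [aeval_heckeChain_of_eq_zero (phi f) 0 x hx0 fun k hk => ?_, aeval_phi]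
  · have h1 : moveToEnd 0 x (Fin.last m) = 0 := by simp [moveToEnd, hx0]
    have h2 : shiftPoint (moveToEnd 0 x) = x := by
      ext k
      refine Fin.cases ?_ (fun k => ?_) k
      · simp [shiftPoint, h1, hx0]
      · simp [shiftPoint, moveToEnd]
    have ht : algebraMap F L t ^ m ≠ 0 := pow_ne_zero _ (by simpa using t_ne_zero)
    rw [h1, h2, zpow_neg, zpow_natCast, map_inv₀, map_pow]
    have cancel : ∀ {L : Type} [Field L] {A B : L}, A ≠ 0 → B + A * ((0 - A⁻¹) * B) = 0 := by
      intro L _ A B hA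
      field_simp
      ring
    exact cancel ht
  · rw [Ne, map_eq_zero_iff _ hinj]
    simp [y, Function.update_of_ne hk, X_ne_zero]

/-- The first Cherednik operator has `G_v` as an eigenfunction. -/
theorem G_add_heckeChain_phi_G (v : Fin (m + 1) → ℕ) :
    G v + heckeChain 0 (phi (G v)) = X 0 * (C (bar (toInt v) 0)⁻¹ * G v) := by
  obtain ⟨p, hp⟩ := X_zero_dvd (G v)
  -- `raise v` has size `|v| + 1`, so `Φ G_v` vanishes at every `w̄` in this range, and the `Hᵢ`
  -- preserve this vanishing.
  have hev : ∀ w, size w ≤ size v →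
      bar (toInt w) 0 * eval (bar (toInt w)) p = eval (bar (toInt w)) (G v) := by
    intro w hw
    have h := congrArg (eval (bar (toInt w))) hp
    rw [map_add, map_mul, eval_X, eval_bar_heckeChain_eq_zero (d := size v) (fun w hw => ?_) 0 w hw,
      add_zero] at h
    · exact h.symm
    · refine eval_bar_phi_G v w (hw.trans (Nat.le_succ _)) ?_
      rintro rfl
      rw [size_raise] at hw
      omega
  have hdeg : p.totalDegree ≤ size v := by
    rcases totalDegree_add_one_of_linear (totalDegree_X _) hp.symm with h | h
    · simp [h]
    · have h1 := (totalDegree_heckeChain_le 0 (phi (G v))).trans (totalDegree_phi_le _)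
      have h2 := totalDegree_add (G v) (heckeChain 0 (phi (G v)))
      have h3 := (G_spec v).1
      have h4 := h2.trans (max_le (h3.trans (Nat.le_succ _)) (h1.trans (Nat.succ_le_succ h3)))
      omega
  have h := eq_C_mul_G v p hdeg fun w hw hne => by
    have := hev w hw
    rw [(G_spec v).2 w hw hne] at this
    exact (mul_eq_zero.mp this).resolve_left (bar_ne_zero _ _)
  have hc : eval (bar (toInt v)) p / eval (bar (toInt v)) (G v) = (bar (toInt v) 0)⁻¹ := by
    rw [div_eq_iff (eval_bar_G_ne_zero v), ← hev v le_rfl,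
      inv_mul_cancel_left₀ (bar_ne_zero _ _)]
  rw [hp, h, hc]

/-! ### Values at `aτ` and `aṽ` -/

theorem G_zero {n : ℕ} : G (0 : Fin n → ℕ) = 1 := by
  have h := G_spec (0 : Fin n → ℕ)
  have hd : (G (0 : Fin n → ℕ)).totalDegree = 0 := by
    simpa [size] using h.1
  rw [totalDegree_eq_zero_iff_eq_C.mp hd, ← C_1, C_inj]
  simpa [show expo (0 : Fin n → ℕ) = 0 from by ext; simp] using h.3

theorem algebraMap_F_K_injective : Function.Injective (algebraMap F K) :=
  (algebraMap F K).injective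

/-- The value `a / v̄₁ - 1`. -/
noncomputable def eigenFactor {m : ℕ} (v : Fin (m + 1) → ℕ) : K :=
  a * algebraMap F K (bar (toInt v) 0)⁻¹ - 1

theorem eigenFactor_ne_zero {m : ℕ} (v : Fin (m + 1) → ℕ) : eigenFactor v ≠ 0 := by
  intro h
  have hb := bar_ne_zero (toInt v) 0
  have h1 : a = algebraMap F K (bar (toInt v) 0) := by
    have hb' : algebraMap F K (bar (toInt v) 0) ≠ 0 := by simpa using hb
    rw [eigenFactor, map_inv₀] at h
    field_simp at h
    linear_combination h
  have h2 : algebraMap (Polynomial F) K Polynomial.X =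
      algebraMap (Polynomial F) K (Polynomial.C (bar (toInt v) 0)) := by
    rw [RatFunc.algebraMap_X, RatFunc.algebraMap_C]
    exact h1
  exact Polynomial.X_ne_C _ (RatFunc.algebraMap_injective F h2)

/-- The value `G_u(a ṽ)`. -/
noncomputable def dualValue {n : ℕ} (u v : Fin n → ℕ) : K :=
  aeval (aMul (tilde (toInt v))) (G u)

theorem dualValue_zero_right {n : ℕ} (u : Fin n → ℕ) : dualValue u 0 = GatTau u := by
  rw [dualValue, show toInt (0 : Fin n → ℕ) = 0 from rfl, tilde_zero, GatTau]

theorem shiftPoint_tilde (v : Fin (m + 1) → ℕ) :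
    shiftPoint (aMul (tilde (toInt v))) = aMul (tilde (toInt (raise v))) := by
  have h : -w0 (toInt v) = raise (-w0 (toInt (raise v))) := by
    ext i
    refine Fin.lastCases ?_ (fun i => ?_) i
    · simp [w0, toInt]
    · simp [w0, toInt, Fin.rev_castSucc, Fin.rev_succ]
  rw [tilde, h]
  exact shiftPoint_scale_bar_raise a _

theorem aMul_tilde_last (v : Fin (m + 1) → ℕ) :
    aMul (tilde (toInt v)) (Fin.last m) - algebraMap F K (t ^ (-(m : ℤ))) =
      algebraMap F K (t ^ (-(m : ℤ))) * eigenFactor v := by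
  have h : (1 : ℤ) - ((m + 1 : ℕ) : ℤ) = -m := by push_cast; ring
  rw [aMul, tilde_eq, Fin.rev_last, eigenFactor, map_mul, h]
  ring

theorem phi_dualValue (u v : Fin (m + 1) → ℕ) :
    aeval (aMul (tilde (toInt v))) (phi (G u)) =
      algebraMap F K (t ^ (-(m : ℤ))) * eigenFactor v * dualValue u (raise v) := by
  rw [aeval_phi, aMul_tilde_last, shiftPoint_tilde, dualValue]

theorem eigenFactor_mul_GatTau (v : Fin (m + 1) → ℕ) :
    aeval (aMul tau) (phi (G v)) = algebraMap F K (t ^ (-(m : ℤ))) * eigenFactor v * GatTau v := by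
  have h := congrArg (aeval (aMul tau)) (G_add_heckeChain_phi_G v)
  simp only [map_add, map_mul, aeval_aMul_tau_heckeChain, aeval_X, aeval_C] at h
  rw [← GatTau] at h
  have h0 : aMul (tau : Fin (m + 1) → F) 0 = a := by simp [aMul, tau]
  have ht : algebraMap F K t ^ m ≠ 0 := pow_ne_zero _ (by simpa using t_ne_zero)
  rw [h0, Fin.val_zero, Nat.sub_zero] at h
  rw [zpow_neg, zpow_natCast, map_inv₀, map_pow, eigenFactor]
  generalize algebraMap F K (bar (toInt v) 0)⁻¹ = b at h ⊢
  field_simp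
  linear_combination h

theorem exists_raise_relations (u : Fin (m + 1) → ℕ) : ∃ c : K,
    c * GatTau (raise u) = algebraMap F K (t ^ (-(m : ℤ))) * eigenFactor u * GatTau u ∧
    ∀ v, c * dualValue (raise u) v =
      algebraMap F K (t ^ (-(m : ℤ))) * eigenFactor v * dualValue u (raise v) := by
  obtain ⟨c, hc⟩ := exists_phi_G_eq u
  refine ⟨algebraMap F K c, ?_, fun v => ?_⟩
  · rw [← eigenFactor_mul_GatTau, hc, map_mul, aeval_C, GatTau]
  · rw [← phi_dualValue, hc, map_mul, aeval_C, dualValue]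

/-- The coefficient depends only on the ratio of two neighbouring coordinates, and inversion
combined with reversal preserves that ratio. -/
theorem heckeCoeff_neg_w0 (v : Fin (m + 1) → ℤ) (i : Fin m) :
    heckeCoeff (-w0 v) i = heckeCoeff v i.rev := by
  have h1 : bar (-w0 v) i.castSucc = t ^ (1 - ((m + 1 : ℕ) : ℤ)) * (bar v i.rev.succ)⁻¹ := by
    rw [← tilde, tilde_eq, Fin.rev_castSucc]
  have h2 : bar (-w0 v) i.succ = t ^ (1 - ((m + 1 : ℕ) : ℤ)) * (bar v i.rev.castSucc)⁻¹ := by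
    rw [← tilde, tilde_eq, Fin.rev_succ]
  have h3 := bar_ne_zero v i.rev.succ
  have h4 := bar_ne_zero v i.rev.castSucc
  have h5 := sub_ne_zero.mpr (bar_castSucc_ne_succ v i.rev)
  rw [heckeCoeff, heckeCoeff, h1, h2, ← mul_sub, mul_left_comm,
    mul_div_mul_left _ _ (zpow_ne_zero _ t_ne_zero), inv_sub_inv h3 h4]
  field_simp

theorem neg_w0_comp_adj (v : Fin (m + 1) → ℤ) (i : Fin m) :
    (-w0 v) ∘ adj i = -w0 (v ∘ adj i.rev) := by
  ext j
  simp only [Function.comp, Pi.neg_apply, w0]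
  congr 2
  simp only [adj, Equiv.swap_apply_def, ← Fin.rev_castSucc, ← Fin.rev_succ, Fin.rev_inj]
  split_ifs <;> simp_all

theorem hecke_dualValue (u v : Fin (m + 1) → ℕ) (i : Fin m) :
    aeval (aMul (tilde (toInt v))) (hecke i (G u)) =
      algebraMap F K (heckeCoeff (toInt v) i.rev) * dualValue u v +
      algebraMap F K (t - heckeCoeff (toInt v) i.rev) * dualValue u (v ∘ adj i.rev) := by
  have h := aeval_scale_bar_hecke (L := K) (s := a) RatFunc.X_ne_zero (-w0 (toInt v)) i (G u)
  rw [heckeCoeff_neg_w0, neg_w0_comp_adj] at h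
  exact h

theorem exists_swap_relations (u : Fin (m + 1) → ℕ) (i : Fin m) : ∃ κ : K,
    κ * GatTau (u ∘ adj i) = algebraMap F K (t - heckeCoeff (toInt u) i) * GatTau u ∧
    ∀ v, algebraMap F K (heckeCoeff (toInt u) i) * dualValue u v +
      κ * dualValue (u ∘ adj i) v =
      algebraMap F K (heckeCoeff (toInt v) i.rev) * dualValue u v +
      algebraMap F K (t - heckeCoeff (toInt v) i.rev) * dualValue u (v ∘ adj i.rev) := by
  obtain ⟨κ, hκ⟩ := exists_hecke_G_eq u i
  refine ⟨algebraMap F K κ, ?_, fun v => ?_⟩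
  · have h := congrArg (aeval (aMul tau)) hκ
    simp only [aeval_aMul_tau_hecke, map_add, map_mul, aeval_C] at h
    rw [map_sub, GatTau, GatTau]
    linear_combination -h
  · rw [← hecke_dualValue, hκ]
    simp only [map_add, map_mul, aeval_C, dualValue]

theorem GatTau_succ_ne_zero (u : Fin (m + 1) → ℕ) : GatTau u ≠ 0 := by
  induction u using composition_induction with
  | zero => simp [GatTau, G_zero]
  | raise u hu =>
    obtain ⟨c, hc, _⟩ := exists_raise_relations u
    refine right_ne_zero_of_mul (a := c) ?_
    rw [hc]
    refine mul_ne_zero (mul_ne_zero ?_ (eigenFactor_ne_zero u)) hu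
    rw [Ne, map_eq_zero_iff _ algebraMap_F_K_injective]
    exact zpow_ne_zero _ t_ne_zero
  | swap u i hu =>
    by_cases h : u i.castSucc = u i.succ
    · rwa [comp_adj_eq_self h]
    · obtain ⟨κ, hκ, _⟩ := exists_swap_relations u i
      refine right_ne_zero_of_mul (a := κ) ?_
      rw [hκ]
      refine mul_ne_zero ?_ hu
      rw [Ne, map_eq_zero_iff _ algebraMap_F_K_injective]
      exact t_sub_heckeCoeff_ne_zero _ i fun e => h (by simpa [toInt] using e)

theorem GatTau_ne_zero : ∀ {n : ℕ} (u : Fin n → ℕ), GatTau u ≠ 0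
  | 0, u => by
    rw [Subsingleton.elim u 0, GatTau, G_zero, map_one]
    exact one_ne_zero
  | _ + 1, u => GatTau_succ_ne_zero u

/-! ### Duality -/

/-- The normalized value `K_u(a ṽ) = G_u(a ṽ) / G_u(a τ)`. -/
noncomputable def normValue {n : ℕ} (u v : Fin n → ℕ) : K := dualValue u v / GatTau u

theorem eigenFactor_mul_normValue_raise (u v : Fin (m + 1) → ℕ) :
    eigenFactor u * normValue (raise u) v = eigenFactor v * normValue u (raise v) := by
  obtain ⟨c, hc, hv⟩ := exists_raise_relations u
  have h1 := GatTau_ne_zero u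
  have h2 := GatTau_ne_zero (raise u)
  have h3 := eigenFactor_ne_zero u
  have ht : algebraMap F K (t ^ (-(m : ℤ))) ≠ 0 := by
    rw [Ne, map_eq_zero_iff _ algebraMap_F_K_injective]
    exact zpow_ne_zero _ t_ne_zero
  have hc0 : c ≠ 0 := fun h0 => by
    rw [h0, zero_mul] at hc
    exact mul_ne_zero (mul_ne_zero ht h3) h1 hc.symm
  rw [normValue, normValue, mul_div_assoc', mul_div_assoc', div_eq_div_iff h2 h1]
  refine mul_left_cancel₀ (mul_ne_zero hc0 ht) ?_
  linear_combination algebraMap F K (t ^ (-(m : ℤ))) * eigenFactor u * GatTau u * hv v -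
    algebraMap F K (t ^ (-(m : ℤ))) * eigenFactor v * dualValue u (raise v) * hc

theorem normValue_swap (u v : Fin (m + 1) → ℕ) (i : Fin m) :
    algebraMap F K (heckeCoeff (toInt u) i) * normValue u v +
      algebraMap F K (t - heckeCoeff (toInt u) i) * normValue (u ∘ adj i) v =
    algebraMap F K (heckeCoeff (toInt v) i.rev) * normValue u v +
      algebraMap F K (t - heckeCoeff (toInt v) i.rev) * normValue u (v ∘ adj i.rev) := by
  obtain ⟨κ, hκ, hv⟩ := exists_swap_relations u i
  have h1 := GatTau_ne_zero u
  have h2 := GatTau_ne_zero (u ∘ adj i)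
  have h := hv v
  simp only [normValue]
  field_simp
  linear_combination GatTau (u ∘ adj i) * h - dualValue (u ∘ adj i) v * hκ

theorem normValue_zero_left {n : ℕ} (v : Fin n → ℕ) : normValue 0 v = 1 := by
  simp [normValue, dualValue, GatTau, G_zero]

theorem normValue_zero_right {n : ℕ} (v : Fin n → ℕ) : normValue v 0 = 1 := by
  rw [normValue, dualValue_zero_right, div_self (GatTau_ne_zero v)]

theorem normValue_comm_succ (u v : Fin (m + 1) → ℕ) : normValue u v = normValue v u := by
  induction u using composition_induction generalizing v with
  | zero => rw [normValue_zero_left, normValue_zero_right]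
  | raise u ih =>
    refine mul_left_cancel₀ (eigenFactor_ne_zero u) ?_
    rw [eigenFactor_mul_normValue_raise, ih, eigenFactor_mul_normValue_raise]
  | swap u i ih =>
    by_cases h : u i.castSucc = u i.succ
    · rw [comp_adj_eq_self h, ih]
    · have hne : algebraMap F K (t - heckeCoeff (toInt u) i) ≠ 0 := by
        rw [Ne, map_eq_zero_iff _ algebraMap_F_K_injective]
        exact t_sub_heckeCoeff_ne_zero _ i fun e => h (by simpa [toInt] using e)
      have h1 := normValue_swap u v i
      have h2 := normValue_swap v u i.rev
      rw [Fin.rev_rev, ← ih v, ← ih (v ∘ adj i.rev)] at h2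
      refine mul_left_cancel₀ hne ?_
      -- By induction the right side of each relation matches the left side of the other, except for
      -- the two terms to be compared.
      linear_combination h1 + h2

/-- Duality of the normalized interpolation polynomials: `K_u(a ṽ) = K_v(a ũ)`. -/
theorem normValue_comm : ∀ {n : ℕ} (u v : Fin n → ℕ), normValue u v = normValue v u
  | 0, u, v => by rw [Subsingleton.elim u v]
  | _ + 1, u, v => normValue_comm_succ u v

/-! ### Density of the points `β̄⁻¹` and the polynomial `O_α` -/

theorem kNum_of_strictAnti {n : ℕ} {v : Fin n → ℤ} (hv : StrictAnti v) (i : Fin n) :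
    kNum v i = i := by
  rw [← kNum_zero i, kNum_eq_sum, kNum_eq_sum]
  refine Finset.sum_congr rfl fun k _ => if_congr ?_ rfl rfl
  simp only [hv.lt_iff_gt, hv.injective.eq_iff, Pi.zero_apply, lt_irrefl, true_and, false_or]
  constructor
  · rintro (h | ⟨rfl, h⟩) <;> exact h
  · exact Or.inl

theorem eq_zero_of_eval_inv_bar {n : ℕ} (p : MvPolynomial (Fin n) K)
    (h : ∀ β : Fin n → ℕ, eval (fun i => algebraMap F K (bar (toInt β) i)⁻¹) p = 0) :
    p = 0 := by
  classical
  set d := p.totalDegree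
  -- The offsets `(d + 1) * i.rev` keep `β` strictly decreasing for all `j_i ≤ d`. The exponent of
  -- `t` is then fixed, each coordinate depends on its own `j_i` alone, and the points form a
  -- product grid.
  let z : Fin n → ℕ → K := fun i j =>
    algebraMap F K (q ^ ((j + (d + 1) * i.rev : ℕ) : ℤ) * t ^ (-((i : ℕ) : ℤ)))⁻¹
  have hz : ∀ i, Function.Injective (z i) := fun i j k e => by
    have := zpow_mul_zpow_inj (inv_injective (algebraMap_F_K_injective e))
    omega
  refine eq_zero_of_eval_zero_at_prod_finset p (fun i => (Finset.range (d + 1)).image (z i))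
    (fun i => ?_) fun x hx => ?_
  · rw [Finset.card_image_of_injective _ (hz i), Finset.card_range]
    exact Nat.lt_succ_of_le (degreeOf_le_totalDegree p i)
  · simp only [Finset.mem_image, Finset.mem_range] at hx
    choose j hj hjx using hx
    have hanti : StrictAnti (toInt fun i => j i + (d + 1) * (i.rev : ℕ)) := by
      intro i k hik
      have h1 : (k.rev : ℕ) + 1 ≤ i.rev := Fin.rev_lt_rev.mpr hik
      have h2 := Nat.mul_le_mul_left (d + 1) h1
      have h3 := hj k
      simp only [toInt, Nat.cast_lt]
      rw [mul_add] at h2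
      omega
    rw [← h fun i => j i + (d + 1) * (i.rev : ℕ)]
    congr 2
    ext i
    rw [← hjx i, bar, kNum_of_strictAnti hanti]
    rfl

theorem aeval_scaledReversal_KPoly {n : ℕ} (α : Fin n → ℕ) :
    aeval (scaledReversal n) (KPoly α) =
      C (GatTau α)⁻¹ * aeval (scaledReversal n) (G α) := by
  rw [KPoly, map_mul, aeval_C, aeval_map_algebraMap, algebraMap_eq]

theorem eval_scaledReversal {n : ℕ} (β : Fin n → ℕ) (i : Fin n) :
    eval (fun i => algebraMap F K (bar (toInt β) i)⁻¹) (scaledReversal n i) =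
      aMul (tilde (toInt β)) i := by
  rw [scaledReversal, aMul, tilde_eq, map_mul, eval_C, eval_X, map_mul]
  ring

theorem isO_scaledReversal {n : ℕ} (α : Fin n → ℕ) :
    IsO α (aeval (scaledReversal n) (KPoly α)) := by
  refine ⟨?_, fun β => ?_⟩
  · refine (totalDegree_aeval_le _ (fun i => ?_) _).trans ?_
    · exact (totalDegree_mul _ _).trans (by rw [totalDegree_C, totalDegree_X])
    · refine (totalDegree_mul _ _).trans ?_
      rw [totalDegree_C, zero_add]
      exact (Finset.sup_mono (support_map_subset _ _)).trans (G_spec α).1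
  · have h : eval (fun i => algebraMap F K (bar (toInt β) i)⁻¹)
        (aeval (scaledReversal n) (G α)) = dualValue α β := by
      rw [dualValue, ← funext (eval_scaledReversal β), ← aeval_eq_eval]
      exact (comp_aeval_apply (scaledReversal n)
        ((aeval fun i => algebraMap F K (bar (toInt β) i)⁻¹ :
          MvPolynomial (Fin n) K →ₐ[K] K).restrictScalars F) (G α))
    rw [aeval_scaledReversal_KPoly, map_mul, eval_C, h, inv_mul_eq_div]
    exact normValue_comm α β

theorem existsUnique_isO {n : ℕ} (α : Fin n → ℕ) : ∃! p, IsO α p := by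
  refine ⟨_, isO_scaledReversal α, fun p hp => sub_eq_zero.mp (eq_zero_of_eval_inv_bar _ ?_)⟩
  intro β
  rw [map_sub, hp.2, (isO_scaledReversal α).2, sub_self]

theorem O_eq {n : ℕ} (α : Fin n → ℕ) : O α = aeval (scaledReversal n) (KPoly α) :=
  (existsUnique_isO α).unique (Classical.epsilon_spec (existsUnique_isO α).exists)
    (isO_scaledReversal α)

end InterpolationMacdonald

theorem theoremC (n : ℕ) (α : Fin n → ℕ) :
    (∃! g : MvPolynomial (Fin n) InterpolationMacdonald.F,
      InterpolationMacdonald.IsInterpolation α g) ∧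
    InterpolationMacdonald.GatTau α ≠ 0 ∧
    (∃! p : MvPolynomial (Fin n) InterpolationMacdonald.K, InterpolationMacdonald.IsO α p) ∧
    InterpolationMacdonald.O α =
      MvPolynomial.aeval (InterpolationMacdonald.scaledReversal n)
        (InterpolationMacdonald.KPoly α) ∧
    InterpolationMacdonald.O α =
      MvPolynomial.C (InterpolationMacdonald.GatTau α)⁻¹ *
        MvPolynomial.aeval (InterpolationMacdonald.scaledReversal n)
          (InterpolationMacdonald.G α) :=
  ⟨InterpolationMacdonald.existsUnique_isInterpolation α,
    InterpolationMacdonald.GatTau_ne_zero α,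
    InterpolationMacdonald.existsUnique_isO α,
    InterpolationMacdonald.O_eq α,
    (InterpolationMacdonald.O_eq α).trans
      (InterpolationMacdonald.aeval_scaledReversal_KPoly α)⟩
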